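/- Let $K$ be a field and let $C$ be a $K$-coalgebra with comultiplication $\Delta(c)=\sum c_1\otimes c_2$. Let $C^*=\mathrm{Hom}_K(C,K)$ be the dual algebra, with product $(f*g)(c)=\sum f(c_1)g(c_2)$ and unit the counit of $C$. For a left $C$-comodule $M$ with coaction $m\mapsto\sum m_{-1}\otimes m_0\in C\otimes M$, the dual $M^*=\mathrm{Hom}_K(M,K)$ is a left $C^*$-module via $(f\cdot\varphi)(m)=\sum f(m_{-1})\varphi(m_0)$, and a comodule morphism $h:M\to N$ induces the $C^*$-linear map $h^*:N^*\to M^*$, $\varphi\mapsto\varphi\circ h$. A left $C$-comodule is Artinian if its subcomodules satisfy the descending chain condition, and finitely cogenerated if it embeds as a comodule in $C^n$ for some positive integer $n$. The coalgebra $C$ is left Artinian if it is Artinian as a left comodule over itself. Then $C$ is left Artinian if and only if $C^*$ is a left Noetherian ring. If this is the case, then: (1) a left $C$-comodule is Artinian if and only if it is finitely cogenerated; (2) a left $C^*$-module is Noetherian if and only if it is finitely generated; (3) the contravariant functor $M\mapsto M^*$, $h\mapsto h^*$, restricts to a duality (contravariant equivalence) from the full subcategory of Artinian (equivalently, finitely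 cogenerated) left $C$-comodules to the full subcategory of Noetherian (equivalently, finitely generated) left $C^*$-modules. -/

import Mathlib

open CategoryTheory TensorProduct

universe u v w

/-- The dual algebra `C^*` of a coalgebra `C`: linear forms on `C` with the convolution product
`(f * g)(c) = ∑ f(c₁) g(c₂)` and unit the counit (Mathlib's ring structure on `WithConv`). -/
abbrev DualAlg (K : Type u) (C : Type v) [Field K] [AddCommGroup C] [Module K C] :
    Type (max u v) :=
  WithConv (C →ₗ[K] K)

/-- A left comodule over the coalgebra `C`: a coassociative and counital coaction
`M → C ⊗ M`, `m ↦ ∑ m₋₁ ⊗ m₀`. -/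
class LeftComodule (K : Type u) (C : Type v) (M : Type w) [Field K] [AddCommGroup C] [Module K C]
    [Coalgebra K C] [AddCommGroup M] [Module K M] where
  coact : M →ₗ[K] C ⊗[K] M
  coassoc : (TensorProduct.assoc K C C M).toLinearMap ∘ₗ
      (Coalgebra.comul (R := K) (A := C)).rTensor M ∘ₗ coact = coact.lTensor C ∘ₗ coact
  counit_coact : (Coalgebra.counit (R := K) (A := C)).rTensor M ∘ₗ coact = TensorProduct.mk K K M 1

namespace LeftComodule

section Basic

variable (K : Type u) (C : Type v) [Field K] [AddCommGroup C] [Module K C] [Coalgebra K C]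
variable (M : Type w) [AddCommGroup M] [Module K M]

/-- The coalgebra `C` as a left comodule over itself. -/
instance self : LeftComodule K C C where
  coact := Coalgebra.comul
  coassoc := Coalgebra.coassoc
  counit_coact := Coalgebra.rTensor_counit_comp_comul

/-- The finite (co)power `M^n` of a left comodule, with the componentwise coaction. -/
instance pi {ι : Type} [Fintype ι] [DecidableEq ι] [LeftComodule K C M] :
    LeftComodule K C (ι → M) where
  coact := ∑ i, (LinearMap.single K (fun _ : ι => M) i).lTensor C ∘ₗ coact ∘ₗ LinearMap.proj i
  coassoc := by
    refine LinearMap.pi_ext' fun i => LinearMap.ext fun m => ?_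
    have h := LinearMap.congr_fun (coassoc (K := K) (C := C) (M := M)) m
    have hc : ∀ x : M, (∑ j, (LinearMap.single K (fun _ : ι => M) j).lTensor C ∘ₗ
        coact ∘ₗ LinearMap.proj j) (Pi.single i x) =
        (LinearMap.single K (fun _ : ι => M) i).lTensor C (coact x) := by
      intro x
      rw [LinearMap.sum_apply, Finset.sum_eq_single i]
      · simp
      · intro j _ hj
        simp [Pi.single_eq_of_ne hj]
      · simp
    have hL : ∀ t : C ⊗[K] M, TensorProduct.assoc K C C (ι → M)
        ((Coalgebra.comul (R := K) (A := C)).rTensor (ι → M)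
          ((LinearMap.single K (fun _ : ι => M) i).lTensor C t)) =
        ((LinearMap.single K (fun _ : ι => M) i).lTensor C).lTensor C
          (TensorProduct.assoc K C C M
            ((Coalgebra.comul (R := K) (A := C)).rTensor M t)) := by
      intro t
      induction t with
      | zero => simp
      | add x y hx hy => simp only [map_add, hx, hy]
      | tmul c x =>
        simp only [LinearMap.lTensor_tmul, LinearMap.rTensor_tmul]
        induction (Coalgebra.comul (R := K) c) with
        | zero => simp
        | add x y hx hy => simp only [map_add, add_tmul, hx, hy]
        | tmul a b => simp
    have hR : ∀ t : C ⊗[K] M, (∑ j, (LinearMap.single K (fun _ : ι => M) j).lTensor C ∘ₗ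
        coact ∘ₗ LinearMap.proj j).lTensor C
          ((LinearMap.single K (fun _ : ι => M) i).lTensor C t) =
        ((LinearMap.single K (fun _ : ι => M) i).lTensor C).lTensor C (coact.lTensor C t) := by
      intro t
      induction t with
      | zero => simp
      | add x y hx hy => simp only [map_add, hx, hy]
      | tmul c x =>
        simp only [LinearMap.lTensor_tmul, LinearMap.coe_single, hc]
    simp only [LinearMap.comp_apply, LinearMap.coe_single, LinearEquiv.coe_coe] at h ⊢
    rw [hc, hL, hR, h]
  counit_coact := by
    refine LinearMap.pi_ext' fun i => LinearMap.ext fun m => ?_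
    have h := LinearMap.congr_fun (counit_coact (K := K) (C := C) (M := M)) m
    have hc : (∑ j, (LinearMap.single K (fun _ : ι => M) j).lTensor C ∘ₗ
        coact ∘ₗ LinearMap.proj j) (Pi.single i m) =
        (LinearMap.single K (fun _ : ι => M) i).lTensor C (coact m) := by
      rw [LinearMap.sum_apply, Finset.sum_eq_single i]
      · simp
      · intro j _ hj
        simp [Pi.single_eq_of_ne hj]
      · simp
    have hL : ∀ t : C ⊗[K] M, (Coalgebra.counit (R := K) (A := C)).rTensor (ι → M)
          ((LinearMap.single K (fun _ : ι => M) i).lTensor C t) =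
        (LinearMap.single K (fun _ : ι => M) i).lTensor K
          ((Coalgebra.counit (R := K) (A := C)).rTensor M t) := by
      intro t
      induction t with
      | zero => simp
      | add x y hx hy => simp only [map_add, hx, hy]
      | tmul c x => simp
    simp only [LinearMap.comp_apply, LinearMap.coe_single] at h ⊢
    rw [hc, hL, h]
    simp

end Basic

section Dual

variable {K : Type u} {C : Type v} [Field K] [AddCommGroup C] [Module K C] [Coalgebra K C]
variable {M : Type w} [AddCommGroup M] [Module K M] [LeftComodule K C M]

/-- The action of `C^*` on `M^*`: `(f • φ)(m) = ∑ f(m₋₁) φ(m₀)`. -/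
noncomputable instance dualSMul : SMul (DualAlg K C) (Module.Dual K M) where
  smul f φ := LinearMap.mul' K K ∘ₗ TensorProduct.map f.ofConv φ ∘ₗ coact

theorem dual_smul_apply (f : DualAlg K C) (φ : Module.Dual K M) (m : M) :
    (f • φ) m = LinearMap.mul' K K (TensorProduct.map f.ofConv φ (coact m)) := rfl

/-- The dual `M^*` of a left `C`-comodule is a left `C^*`-module. -/
noncomputable instance dualModule : Module (DualAlg K C) (Module.Dual K M) where
  one_smul φ := by
    ext m
    have h := LinearMap.congr_fun (counit_coact (K := K) (C := C) (M := M)) m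
    have hL : ∀ t : C ⊗[K] M, LinearMap.mul' K K
        (TensorProduct.map (1 : DualAlg K C).ofConv φ t) =
        LinearMap.mul' K K (φ.lTensor K ((Coalgebra.counit (R := K) (A := C)).rTensor M t)) := by
      intro t
      induction t with
      | zero => simp
      | add x y hx hy => simp only [map_add, hx, hy]
      | tmul c x => simp [LinearMap.convOne_def]
    simp only [LinearMap.comp_apply] at h
    rw [dual_smul_apply, hL, h]
    simp
  mul_smul f g φ := by
    ext m
    have h := LinearMap.congr_fun (coassoc (K := K) (C := C) (M := M)) m
    have hL : ∀ t : C ⊗[K] M, LinearMap.mul' K K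
        (TensorProduct.map (f * g).ofConv φ t) =
        LinearMap.mul' K K (TensorProduct.map f.ofConv
          (LinearMap.mul' K K ∘ₗ TensorProduct.map g.ofConv φ)
          (TensorProduct.assoc K C C M
            ((Coalgebra.comul (R := K) (A := C)).rTensor M t))) := by
      intro t
      induction t with
      | zero => simp
      | add x y hx hy => simp only [map_add, hx, hy]
      | tmul c x =>
        simp only [LinearMap.rTensor_tmul, LinearMap.convMul_def, TensorProduct.map_tmul,
          LinearMap.comp_apply, LinearMap.mul'_apply]
        induction (Coalgebra.comul (R := K) c) with
        | zero => simp
        | add x y hx hy => simp only [map_add, add_tmul, add_mul, hx, hy]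
        | tmul a b => simp [mul_assoc]
    have hR : ∀ t : C ⊗[K] M, LinearMap.mul' K K (TensorProduct.map f.ofConv (g • φ) t) =
        LinearMap.mul' K K (TensorProduct.map f.ofConv
          (LinearMap.mul' K K ∘ₗ TensorProduct.map g.ofConv φ) (coact.lTensor C t)) := by
      intro t
      induction t with
      | zero => simp
      | add x y hx hy => simp only [map_add, hx, hy]
      | tmul c x => simp [dual_smul_apply]
    simp only [LinearMap.comp_apply, LinearEquiv.coe_coe] at h
    rw [dual_smul_apply, dual_smul_apply, hL, hR, h]
  smul_zero f := by
    ext m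
    simp [dual_smul_apply, TensorProduct.map_zero_right]
  smul_add f φ ψ := by
    ext m
    simp [dual_smul_apply, TensorProduct.map_add_right]
  add_smul f g φ := by
    ext m
    simp [dual_smul_apply, TensorProduct.map_add_left]
  zero_smul φ := by
    ext m
    simp [dual_smul_apply, TensorProduct.map_zero_left]

end Dual

section Properties

variable (K : Type u) (C : Type v) [Field K] [AddCommGroup C] [Module K C] [Coalgebra K C]
variable (M : Type w) [AddCommGroup M] [Module K M] [LeftComodule K C M]

/-- A subspace `N ⊆ M` is a subcomodule if the coaction maps it into `C ⊗ N ⊆ C ⊗ M`. -/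
def IsSubcomodule (N : Submodule K M) : Prop :=
  ∀ m ∈ N, coact (K := K) (C := C) m ∈ LinearMap.range (N.subtype.lTensor C)

/-- A left comodule is Artinian if its subcomodules satisfy the descending chain condition. -/
def IsArtinianComodule : Prop :=
  WellFoundedLT {N : Submodule K M // IsSubcomodule K C M N}

variable {K M} in
/-- A linear map of left comodules is a comodule morphism if it commutes with the coactions. -/
def IsComoduleHom {N : Type*} [AddCommGroup N] [Module K N] [LeftComodule K C N]
    (f : M →ₗ[K] N) : Prop :=
  f.lTensor C ∘ₗ coact = coact ∘ₗ f

/-- A left comodule is finitely cogenerated if it embeds, as a comodule, in `C^n` for some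
positive integer `n`. -/
def IsFinitelyCogenerated : Prop :=
  ∃ n : ℕ, 0 < n ∧ ∃ f : M →ₗ[K] (Fin n → C), IsComoduleHom C f ∧ Function.Injective f

end Properties

end LeftComodule

/-- A coalgebra is left Artinian if it is Artinian as a left comodule over itself. -/
def IsLeftArtinianCoalgebra (K : Type u) (C : Type v) [Field K] [AddCommGroup C] [Module K C]
    [Coalgebra K C] : Prop :=
  LeftComodule.IsArtinianComodule K C C

/-- Objects of the category of left `C`-comodules. -/
structure LeftComod (K : Type u) (C : Type v) [Field K] [AddCommGroup C] [Module K C]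
    [Coalgebra K C] where
  carrier : Type v
  [addCommGroup : AddCommGroup carrier]
  [module : Module K carrier]
  [comodule : LeftComodule K C carrier]

namespace LeftComod

attribute [instance] addCommGroup module comodule

section

variable {K : Type u} {C : Type v} [Field K] [AddCommGroup C] [Module K C] [Coalgebra K C]

/-- Morphisms of left comodules. -/
@[ext]
structure Hom (X Y : LeftComod K C) where
  toLin : X.carrier →ₗ[K] Y.carrier
  isHom : LeftComodule.IsComoduleHom C toLin

/-- The category of left `C`-comodules. -/
instance : Category (LeftComod K C) where
  Hom X Y := Hom X Y
  id X := ⟨LinearMap.id, by simp [LeftComodule.IsComoduleHom]⟩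
  comp {X Y Z} f g := ⟨g.toLin ∘ₗ f.toLin, by
    have hf := f.isHom
    have hg := g.isHom
    unfold LeftComodule.IsComoduleHom at hf hg ⊢
    rw [LinearMap.lTensor_comp, LinearMap.comp_assoc, hf, ← LinearMap.comp_assoc, hg,
      LinearMap.comp_assoc]⟩

end

variable (K : Type u) (C : Type v) [Field K] [AddCommGroup C] [Module K C] [Coalgebra K C]

/-- The contravariant functor `M ↦ M^*`, `h ↦ h^* = (φ ↦ φ ∘ h)`, from left `C`-comodules to left
`C^*`-modules. -/
noncomputable def dualFunctor : (LeftComod K C)ᵒᵖ ⥤ ModuleCat.{max u v} (DualAlg K C) where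
  obj X := ModuleCat.of (DualAlg K C) (Module.Dual K X.unop.carrier)
  map {X Y} h := ModuleCat.ofHom
    { toFun := fun φ => φ ∘ₗ h.unop.toLin
      map_add' := fun φ ψ => LinearMap.add_comp _ _ _
      map_smul' := fun f φ => by
        ext m
        have hh := LinearMap.congr_fun h.unop.isHom m
        simp only [LinearMap.comp_apply] at hh
        have hL : ∀ t : C ⊗[K] Y.unop.carrier,
            TensorProduct.map f.ofConv φ (h.unop.toLin.lTensor C t) =
            TensorProduct.map f.ofConv (φ ∘ₗ h.unop.toLin) t := by
          intro t
          rw [LinearMap.lTensor, ← LinearMap.comp_apply, ← TensorProduct.map_comp,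
            LinearMap.comp_id]
        simp only [LinearMap.comp_apply, LeftComodule.dual_smul_apply, RingHom.id_apply]
        rw [← hh, hL] }

/-- The Artinian left comodules. -/
def artinian : ObjectProperty (LeftComod K C) :=
  fun X => LeftComodule.IsArtinianComodule K C X.carrier

/-- The finitely cogenerated left comodules. -/
def finitelyCogenerated : ObjectProperty (LeftComod K C) :=
  fun X => LeftComodule.IsFinitelyCogenerated K C X.carrier

/-- The Noetherian left `C^*`-modules. -/
def noetherian : ObjectProperty (ModuleCat.{max u v} (DualAlg K C)) :=
  fun N => IsNoetherian (DualAlg K C) N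

/-- The finitely generated left `C^*`-modules. -/
def finitelyGenerated : ObjectProperty (ModuleCat.{max u v} (DualAlg K C)) :=
  fun N => Module.Finite (DualAlg K C) N

/-- `M ↦ M^*` is a duality between the full subcategories of the left `C`-comodules satisfying `P`
and the left `C^*`-modules satisfying `Q`: it maps the former to the latter, and the resulting
contravariant functor is an equivalence of categories. -/
def IsDuality (P : ObjectProperty (LeftComod K C))
    (Q : ObjectProperty (ModuleCat.{max u v} (DualAlg K C))) : Prop :=
  ∃ h : ∀ X : P.FullSubcategoryᵒᵖ, Q ((P.ι.op ⋙ dualFunctor K C).obj X),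
    (Q.lift (P.ι.op ⋙ dualFunctor K C) h).IsEquivalence

end LeftComod

/-! A form `f` on `C` acts on `M` by `act f`, and `f • φ = φ ∘ act f` on the dual. Forms on `C`
separate the elements of `C ⊗ M`, so subcomodules are the stable subspaces and comodule morphisms
the linear maps commuting with the action.

`C` is cofree: a form `φ` on `M` corresponds to the comodule morphism `cogen φ : M → C`. A finite
family `φ` thus gives a morphism `M → C^n` whose transpose is `(fᵢ) ↦ ∑ fᵢ • φᵢ`. Over a field, the
range of a transpose is the annihilator of the kernel, so every finitely generated `W ⊆ M^*` is
recovered from its common kernel (`mem_of_vanish_coannihilator`). Consequently `M` is Artinian iff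
`M^*` is Noetherian, and `M` is finitely cogenerated iff `M^*` is finitely generated, for any `C`;
the case `M = C` gives the criterion for `C^*`.

The Noetherian hypothesis identifies the finiteness conditions and makes the kernel of a
presentation `(C^n)^* → X` finitely generated, so that `X` is the dual of a subcomodule of `C^n`.
Fullness (`exists_dualHom_eq`) needs only finite cogeneration. -/

namespace LeftComodule

/-! ### Comodules through the action of linear forms, and cofreeness of `C` -/

section Action

variable {K : Type u} {C : Type v} [Field K] [AddCommGroup C] [Module K C]

/-- Contraction of the left tensor factor against a linear form: `c ⊗ m ↦ f(c) m`. -/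
noncomputable def contract {M : Type w} [AddCommGroup M] [Module K M] (f : DualAlg K C) :
    C ⊗[K] M →ₗ[K] M :=
  (TensorProduct.lid K M).toLinearMap ∘ₗ f.ofConv.rTensor M

@[simp]
theorem contract_tmul {M : Type w} [AddCommGroup M] [Module K M] (f : DualAlg K C) (c : C)
    (m : M) : contract f (c ⊗ₜ[K] m) = f.ofConv c • m := by
  simp [contract]

theorem contract_lTensor {M : Type*} {N : Type*} [AddCommGroup M] [Module K M] [AddCommGroup N]
    [Module K N] (f : DualAlg K C) (h : M →ₗ[K] N) (t : C ⊗[K] M) :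
    contract f (h.lTensor C t) = h (contract f t) := by
  induction t with
  | zero => simp
  | add x y hx hy => simp only [map_add, hx, hy]
  | tmul c x => rw [LinearMap.lTensor_tmul, contract_tmul, contract_tmul, map_smul]

/-- Expand the left factor in a basis of `C`: contraction with the coordinate forms reads off the
coefficients in `M`. -/
theorem eq_zero_of_contract {M : Type w} [AddCommGroup M] [Module K M] {t : C ⊗[K] M}
    (h : ∀ f : DualAlg K C, contract f t = 0) : t = 0 := by
  classical
  let b := Module.Basis.ofVectorSpace K C
  refine (TensorProduct.equivFinsuppOfBasisLeft (N := M) b).injective ?_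
  ext i
  rw [map_zero, Finsupp.zero_apply, ← h (WithConv.toConv (b.coord i))]
  clear h
  induction t with
  | zero => simp
  | add x y hx hy => simp only [map_add, Finsupp.add_apply, hx, hy]
  | tmul c x => simp

theorem contract_ext {M : Type w} [AddCommGroup M] [Module K M] {s t : C ⊗[K] M}
    (h : ∀ f : DualAlg K C, contract f s = contract f t) : s = t :=
  sub_eq_zero.1 (eq_zero_of_contract fun f => by rw [map_sub, h, sub_self])

theorem eq_of_dual_eq {K : Type u} [Field K] {V : Type*} [AddCommGroup V] [Module K V] {x y : V}
    (h : ∀ φ : Module.Dual K V, φ x = φ y) : x = y :=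
  sub_eq_zero.1 ((Module.forall_dual_apply_eq_zero_iff K (x - y)).1 fun φ => by
    rw [map_sub, h, sub_self])

theorem dual_pi_apply {ι : Type} [Fintype ι] [DecidableEq ι] (F : Module.Dual K (ι → C))
    (x : ι → C) :
    F x = ∑ i, F (Pi.single i (x i)) := by
  conv_lhs => rw [← Finset.univ_sum_single x, map_sum]

variable [Coalgebra K C] {M : Type w} [AddCommGroup M] [Module K M] [LeftComodule K C M]

/-- The action of a linear form on a left comodule: `m ↦ ∑ f(m₋₁) m₀`. -/
noncomputable def act (f : DualAlg K C) : M →ₗ[K] M :=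
  contract f ∘ₗ coact

theorem dual_smul_apply_eq_act (f : DualAlg K C) (φ : Module.Dual K M) (m : M) :
    (f • φ) m = φ (act f m) := by
  rw [dual_smul_apply, act, LinearMap.comp_apply]
  induction coact (K := K) (C := C) m with
  | zero => simp
  | add x y hx hy => simp only [map_add, hx, hy]
  | tmul c x => simp

/-- By exactness of `C ⊗ N → C ⊗ M → C ⊗ M/N`, membership in `C ⊗ N` is vanishing in `C ⊗ M/N`,
which contractions detect. -/
theorem isSubcomodule_iff_act {N : Submodule K M} :
    IsSubcomodule K C M N ↔ ∀ (f : DualAlg K C), ∀ m ∈ N, act f m ∈ N := by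
  have hex := lTensor_exact C (f := N.subtype) (g := N.mkQ)
    (LinearMap.exact_subtype_mkQ N) N.mkQ_surjective
  constructor
  · intro h f m hm
    obtain ⟨t, ht⟩ := h m hm
    rw [act, LinearMap.comp_apply, ← ht, contract_lTensor]
    exact (contract f t).2
  · intro h m hm
    refine (hex _).1 (eq_zero_of_contract fun f => ?_)
    rw [contract_lTensor, Submodule.mkQ_apply, Submodule.Quotient.mk_eq_zero]
    exact h f m hm

theorem isComoduleHom_iff_act {N : Type*} [AddCommGroup N] [Module K N] [LeftComodule K C N]
    {h : M →ₗ[K] N} :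
    IsComoduleHom C h ↔ ∀ (f : DualAlg K C) (m : M), h (act f m) = act f (h m) := by
  constructor
  · intro hh f m
    rw [act, act, LinearMap.comp_apply, LinearMap.comp_apply, ← LinearMap.comp_apply coact h,
      ← hh, LinearMap.comp_apply, contract_lTensor]
  · intro hh
    refine LinearMap.ext fun m => contract_ext fun f => ?_
    rw [LinearMap.comp_apply, contract_lTensor]
    exact hh f m

theorem act_pi {ι : Type} [Fintype ι] [DecidableEq ι] (f : DualAlg K C) (x : ι → M) (i : ι) :
    act f x i = act f (x i) := by
  have h : coact (K := K) (C := C) x =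
      ∑ j, (LinearMap.single K (fun _ : ι => M) j).lTensor C (coact (x j)) := by
    simp only [coact, LinearMap.sum_apply, LinearMap.comp_apply, LinearMap.proj_apply]
  rw [act, LinearMap.comp_apply, h, map_sum, Finset.sum_apply, Finset.sum_eq_single i]
  · rw [contract_lTensor]
    simp [act]
  · intro j _ hj
    rw [contract_lTensor]
    simp [Pi.single_eq_of_ne hj.symm]
  · simp

/-- The dual of a comodule morphism as a `C^*`-linear map. -/
def dualHom {N : Type*} [AddCommGroup N] [Module K N] [LeftComodule K C N]
    (h : M →ₗ[K] N) (hh : IsComoduleHom C h) :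
    Module.Dual K N →ₗ[DualAlg K C] Module.Dual K M where
  toFun φ := φ ∘ₗ h
  map_add' _ _ := LinearMap.add_comp _ _ _
  map_smul' f φ := by
    ext m
    rw [LinearMap.comp_apply, dual_smul_apply_eq_act, RingHom.id_apply, dual_smul_apply_eq_act,
      LinearMap.comp_apply, isComoduleHom_iff_act.1 hh]

/-- The left regular module `C^*` is the dual of the comodule `C`. -/
def dualSelfEquiv : Module.Dual K C ≃ₗ[DualAlg K C] DualAlg K C where
  toFun φ := WithConv.toConv φ
  invFun f := f.ofConv
  map_add' _ _ := rfl
  map_smul' _ _ := rfl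
  left_inv _ := rfl
  right_inv _ := rfl

/-- The comodule morphism `M → C`, `m ↦ ∑ φ(m₀) m₋₁`, attached to a linear form on `M`. -/
noncomputable def cogen (φ : Module.Dual K M) : M →ₗ[K] C :=
  (TensorProduct.rid K C).toLinearMap ∘ₗ φ.lTensor C ∘ₗ coact

theorem apply_cogen (f : DualAlg K C) (φ : Module.Dual K M) (m : M) :
    f.ofConv (cogen φ m) = (f • φ) m := by
  rw [dual_smul_apply, cogen, LinearMap.comp_apply, LinearMap.comp_apply]
  induction coact (K := K) (C := C) m with
  | zero => simp
  | add x y hx hy => simp only [map_add, hx, hy]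
  | tmul c x => simp [mul_comm]

theorem counit_comp_cogen (φ : Module.Dual K M) :
    (Coalgebra.counit (R := K) (A := C)) ∘ₗ cogen φ = φ := by
  ext m
  have h := apply_cogen (1 : DualAlg K C) φ m
  rw [one_smul] at h
  rw [← h]
  rfl

/-- Tested against `ψ`, both sides equal `((f * ψ) • φ) m`, by associativity of the action on `M^*`.
-/
theorem isComoduleHom_cogen (φ : Module.Dual K M) : IsComoduleHom C (cogen (C := C) φ) := by
  refine isComoduleHom_iff_act.2 fun f m => eq_of_dual_eq (K := K) fun ψ => ?_
  have h1 := apply_cogen (WithConv.toConv ψ) φ (act f m)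
  have h2 := apply_cogen (f * WithConv.toConv ψ) φ m
  have h3 : (f * WithConv.toConv ψ) • φ = f • (WithConv.toConv ψ : DualAlg K C) • φ :=
    mul_smul f (WithConv.toConv ψ : DualAlg K C) φ
  rw [← dual_smul_apply_eq_act, ← h3, ← h2] at h1
  rw [← dual_smul_apply_eq_act]
  exact h1

/-- With `counit_comp_cogen`, this is the bijection between forms on `M` and comodule morphisms `M →
C`. It comes from the right unit law `ψ * ε = ψ` in `C^*`. -/
theorem eq_cogen {h : M →ₗ[K] C} (hh : IsComoduleHom C h) :
    h = cogen (Coalgebra.counit (R := K) (A := C) ∘ₗ h) := by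
  refine LinearMap.ext fun m => eq_of_dual_eq (K := K) fun ψ => ?_
  have h1 := apply_cogen (WithConv.toConv ψ) (Coalgebra.counit (R := K) (A := C) ∘ₗ h) m
  have h2 : (WithConv.toConv ψ : DualAlg K C) • (Coalgebra.counit (R := K) (A := C)) = ψ := by
    have h3 := mul_one (WithConv.toConv ψ : DualAlg K C)
    exact congrArg WithConv.ofConv h3
  refine Eq.trans ?_ h1.symm
  rw [dual_smul_apply_eq_act, LinearMap.comp_apply, isComoduleHom_iff_act.1 hh,
    ← dual_smul_apply_eq_act, h2]

/-- The comodule morphism `M → C^ι` attached to a family of linear forms on `M`. -/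
noncomputable def cogenPi {ι : Type} (φ : ι → Module.Dual K M) : M →ₗ[K] ι → C :=
  LinearMap.pi fun i => cogen (φ i)

variable {ι : Type} [Fintype ι] [DecidableEq ι]

theorem isComoduleHom_cogenPi (φ : ι → Module.Dual K M) :
    IsComoduleHom C (cogenPi (C := C) φ) := by
  refine isComoduleHom_iff_act.2 fun f m => funext fun i => ?_
  rw [act_pi]
  exact isComoduleHom_iff_act.1 (isComoduleHom_cogen (φ i)) f m

theorem isComoduleHom_proj (i : ι) :
    IsComoduleHom C (LinearMap.proj i : (ι → M) →ₗ[K] M) :=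
  isComoduleHom_iff_act.2 fun f m => act_pi f m i

theorem IsComoduleHom.comp {N P : Type*} [AddCommGroup N] [Module K N] [LeftComodule K C N]
    [AddCommGroup P] [Module K P] [LeftComodule K C P] {g : N →ₗ[K] P} {h : M →ₗ[K] N}
    (hg : IsComoduleHom C g) (hh : IsComoduleHom C h) : IsComoduleHom C (g ∘ₗ h) :=
  isComoduleHom_iff_act.2 fun f m => by
    rw [LinearMap.comp_apply, LinearMap.comp_apply, isComoduleHom_iff_act.1 hh,
      isComoduleHom_iff_act.1 hg]

theorem eq_cogenPi {h : M →ₗ[K] ι → C} (hh : IsComoduleHom C h) :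
    h = cogenPi fun i => Coalgebra.counit (R := K) (A := C) ∘ₗ LinearMap.proj i ∘ₗ h := by
  refine LinearMap.ext fun m => funext fun i => ?_
  exact LinearMap.congr_fun (eq_cogen ((isComoduleHom_proj i).comp hh)) m

theorem dual_apply_cogenPi (F : Module.Dual K (ι → C)) (φ : ι → Module.Dual K M) (m : M) :
    F (cogenPi φ m) = (∑ i,
      (WithConv.toConv (F ∘ₗ LinearMap.single K (fun _ : ι => C) i) : DualAlg K C) • φ i) m := by
  rw [dual_pi_apply, LinearMap.sum_apply]
  exact Finset.sum_congr rfl fun i _ => apply_cogen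
    (WithConv.toConv (F ∘ₗ LinearMap.single K (fun _ : ι => C) i)) (φ i) m

end Action

/-! ### Annihilators, finiteness conditions and fullness -/

section Annihilators

variable {K : Type u} {C : Type v} [Field K] [AddCommGroup C] [Module K C] [Coalgebra K C]
variable {M : Type w} [AddCommGroup M] [Module K M] [LeftComodule K C M]

/-- The common kernel of the linear forms in a `C^*`-submodule of `M^*`. -/
def coannihilator (W : Submodule (DualAlg K C) (Module.Dual K M)) : Submodule K M where
  carrier := {m | ∀ φ ∈ W, φ m = 0}
  add_mem' ha hb φ hφ := by rw [map_add, ha φ hφ, hb φ hφ, add_zero]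
  zero_mem' φ _ := map_zero φ
  smul_mem' r m hm φ hφ := by rw [map_smul, hm φ hφ, smul_zero]

theorem isSubcomodule_coannihilator (W : Submodule (DualAlg K C) (Module.Dual K M)) :
    IsSubcomodule K C M (coannihilator W) :=
  isSubcomodule_iff_act.2 fun f m hm φ hφ => by
    rw [← dual_smul_apply_eq_act]
    exact hm _ (W.smul_mem f hφ)

/-- The `C^*`-submodule of `M^*` of the linear forms vanishing on a subcomodule. -/
def annihilator (N : Submodule K M) (hN : IsSubcomodule K C M N) :
    Submodule (DualAlg K C) (Module.Dual K M) where
  carrier := {φ | ∀ m ∈ N, φ m = 0}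
  add_mem' ha hb m hm := by rw [LinearMap.add_apply, ha m hm, hb m hm, add_zero]
  zero_mem' _ _ := rfl
  smul_mem' f φ hφ m hm := by
    rw [dual_smul_apply_eq_act]
    exact hφ _ (isSubcomodule_iff_act.1 hN f m hm)

/-- A form vanishing on the kernel factors as `F ∘ cogenPi φ`; the restrictions of `F` to the
coordinates of `C^ι` are the coefficients of the combination. -/
theorem mem_span_of_forall_ker_cogenPi {ι : Type} [Fintype ι] [DecidableEq ι]
    {φ : ι → Module.Dual K M} {ψ : Module.Dual K M}
    (h : ∀ m, cogenPi (C := C) φ m = 0 → ψ m = 0) :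
    ψ ∈ Submodule.span (DualAlg K C) (Set.range φ) := by
  have h1 : ψ ∈ (LinearMap.ker (cogenPi (C := C) φ)).dualAnnihilator :=
    (Submodule.mem_dualAnnihilator _).2 fun m hm => h m hm
  rw [← LinearMap.range_dualMap_eq_dualAnnihilator_ker] at h1
  obtain ⟨F, rfl⟩ := h1
  refine (Submodule.mem_span_range_iff_exists_fun _).2
    ⟨fun i => WithConv.toConv (F ∘ₗ LinearMap.single K (fun _ : ι => C) i), ?_⟩
  ext m
  exact (dual_apply_cogenPi F φ m).symm

theorem cogenPi_eq_zero_iff {ι : Type} {φ : ι → Module.Dual K M} {m : M} :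
    cogenPi (C := C) φ m = 0 ↔
      m ∈ coannihilator (Submodule.span (DualAlg K C) (Set.range φ)) := by
  constructor
  · intro h ψ hψ
    induction hψ using Submodule.span_induction generalizing m with
    | mem x hx =>
      obtain ⟨i, rfl⟩ := hx
      rw [← counit_comp_cogen (C := C) (φ i), LinearMap.comp_apply]
      have := congrFun h i
      change cogen (φ i) m = 0 at this
      rw [this, map_zero]
    | zero => rfl
    | add x y _ _ hx hy => rw [LinearMap.add_apply, hx h, hy h, add_zero]
    -- The kernel is stable under `act f`, so the induction hypothesis, general in `m`, is applied
    -- at `act f m`.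
    | smul f x _ hx =>
      rw [dual_smul_apply_eq_act]
      refine hx (funext fun i => ?_)
      have := isComoduleHom_iff_act.1 (isComoduleHom_cogen (C := C) (φ i)) f m
      have h0 : cogen (C := C) (φ i) m = 0 := congrFun h i
      rw [h0, map_zero] at this
      exact this
  · intro h
    refine funext fun i => eq_of_dual_eq (K := K) fun ψ => ?_
    refine (apply_cogen (WithConv.toConv ψ) (φ i) m).trans ?_
    rw [h _ (Submodule.smul_mem _ _ (Submodule.subset_span ⟨i, rfl⟩))]
    exact (map_zero ψ).symm

theorem mem_of_vanish_coannihilator {W : Submodule (DualAlg K C) (Module.Dual K M)}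
    (hW : W.FG) {ψ : Module.Dual K M} (h : ∀ m ∈ coannihilator W, ψ m = 0) : ψ ∈ W := by
  obtain ⟨n, φ, rfl⟩ := Submodule.fg_iff_exists_fin_generating_family.1 hW
  exact mem_span_of_forall_ker_cogenPi fun m hm => h m (cogenPi_eq_zero_iff.1 hm)

/-- Both directions use a strictly order-reversing map. Coannihilators are strict only on finitely
generated submodules, but the ascending chain condition for these already gives Noetherianity. -/
theorem isArtinianComodule_iff_isNoetherian_dual :
    IsArtinianComodule K C M ↔ IsNoetherian (DualAlg K C) (Module.Dual K M) := by
  constructor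
  · intro h
    have : WellFoundedLT {N : Submodule K M // IsSubcomodule K C M N} := h
    rw [isNoetherian_iff_fg_wellFounded]
    refine StrictAnti.wellFoundedGT
      (f := fun W : {W : Submodule (DualAlg K C) (Module.Dual K M) // W.FG} =>
        (⟨coannihilator W.1, isSubcomodule_coannihilator W.1⟩ :
          {N : Submodule K M // IsSubcomodule K C M N})) ?_
    intro V W hVW
    refine lt_of_le_not_ge (fun m hm φ hφ => hm φ (hVW.le hφ)) fun hle => ?_
    exact hVW.not_ge fun φ hφ => mem_of_vanish_coannihilator V.2 fun m hm => hle hm φ hφ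
  · intro h
    have := isNoetherian_iff'.1 h
    refine StrictAnti.wellFoundedLT
      (f := fun N : {N : Submodule K M // IsSubcomodule K C M N} => annihilator N.1 N.2) ?_
    intro N P hNP
    refine lt_of_le_not_ge (fun φ hφ m hm => hφ m (hNP.le hm)) fun hle => ?_
    refine hNP.not_ge fun m hm => ?_
    by_contra hmN
    -- A form that vanishes on `N` but not at `m`.
    obtain ⟨φ, hφ, hle'⟩ := Submodule.exists_le_ker_of_notMem hmN
    exact hφ (hle (fun x hx => hle' hx : φ ∈ annihilator N.1 N.2) m hm)

theorem injective_cogenPi_iff {ι : Type} [Fintype ι] [DecidableEq ι] {φ : ι → Module.Dual K M} :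
    Function.Injective (cogenPi (C := C) φ) ↔
      Submodule.span (DualAlg K C) (Set.range φ) = ⊤ := by
  constructor
  · intro h
    refine eq_top_iff.2 fun ψ _ => mem_span_of_forall_ker_cogenPi fun m hm => ?_
    rw [h (hm.trans (map_zero _).symm), map_zero]
  · intro h
    refine (injective_iff_map_eq_zero _).2 fun m hm => ?_
    rw [cogenPi_eq_zero_iff, h] at hm
    exact (Module.forall_dual_apply_eq_zero_iff K m).1 fun φ => hm φ trivial

theorem isFinitelyCogenerated_iff_finite_dual :
    IsFinitelyCogenerated K C M ↔ Module.Finite (DualAlg K C) (Module.Dual K M) := by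
  constructor
  · rintro ⟨n, -, f, hf, hinj⟩
    rw [eq_cogenPi hf] at hinj
    exact ⟨Submodule.fg_iff_exists_fin_generating_family.2
      ⟨n, _, injective_cogenPi_iff.1 hinj⟩⟩
  · intro h
    obtain ⟨n, φ, hφ⟩ := Module.Finite.exists_fin (R := DualAlg K C) (M := Module.Dual K M)
    -- The zero form is prepended because the exponent must be positive even when the generating
    -- family is empty.
    have hφ' : Submodule.span (DualAlg K C)
        (Set.range (Fin.cons 0 φ : Fin (n + 1) → Module.Dual K M)) = ⊤ := by
      rw [eq_top_iff, ← hφ, Fin.range_cons]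
      exact Submodule.span_mono (Set.subset_insert _ _)
    exact ⟨n + 1, n.succ_pos, cogenPi (Fin.cons 0 φ), isComoduleHom_cogenPi _,
      injective_cogenPi_iff.2 hφ'⟩

/-- The generators `φ` of `N^*` embed `N` in `C^n`, and a morphism inducing `α` must satisfy
`cogenPi φ ∘ h = cogenPi (α ∘ φ)`. It exists because the right side lands in the image of `N`. -/
theorem exists_dualHom_eq {N : Type*} [AddCommGroup N] [Module K N] [LeftComodule K C N]
    (hN : IsFinitelyCogenerated K C N)
    (α : Module.Dual K N →ₗ[DualAlg K C] Module.Dual K M) :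
    ∃ (h : M →ₗ[K] N) (hh : IsComoduleHom C h), dualHom h hh = α := by
  obtain ⟨n, -, g, hg, hinj⟩ := hN
  rw [eq_cogenPi hg] at hinj
  set φ : Fin n → Module.Dual K N :=
    fun i => Coalgebra.counit (R := K) (A := C) ∘ₗ LinearMap.proj i ∘ₗ g
  have hspan := injective_cogenPi_iff.1 hinj
  have hrange : ∀ m : M, cogenPi (C := C) (fun i => α (φ i)) m ∈
      LinearMap.range (cogenPi (C := C) φ) := by
    intro m
    -- A form `F` on `C^n` killing the image of `N` is a relation among the `φ i`; `α` preserves it,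
    -- so `F` also kills the given vector.
    by_contra hm
    obtain ⟨F, hF, hle⟩ := Submodule.exists_le_ker_of_notMem hm
    refine hF ?_
    rw [dual_apply_cogenPi]
    simp only [← map_smul, ← map_sum]
    have h0 : (∑ i, (WithConv.toConv (F ∘ₗ LinearMap.single K (fun _ : Fin n => C) i) :
        DualAlg K C) • φ i) = 0 := by
      ext x
      rw [← dual_apply_cogenPi]
      exact hle ⟨x, rfl⟩
    rw [h0, map_zero, LinearMap.zero_apply]
  let e := LinearEquiv.ofInjective (cogenPi (C := C) φ) hinj
  let h : M →ₗ[K] N := e.symm.toLinearMap ∘ₗ LinearMap.codRestrict _ _ hrange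
  have hcomp : ∀ m, cogenPi (C := C) φ (h m) = cogenPi (C := C) (fun i => α (φ i)) m := by
    intro m
    exact congrArg Subtype.val (e.apply_symm_apply ⟨_, hrange m⟩)
  have hh : IsComoduleHom C h := isComoduleHom_iff_act.2 fun f m => hinj (by
    rw [hcomp, isComoduleHom_iff_act.1 (isComoduleHom_cogenPi _),
      isComoduleHom_iff_act.1 (isComoduleHom_cogenPi _), hcomp])
  refine ⟨h, hh, LinearMap.ext_on_range hspan fun i => ?_⟩
  ext m
  have h1 := LinearMap.congr_fun (counit_comp_cogen (C := C) (φ i)) (h m)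
  have h2 := LinearMap.congr_fun (counit_comp_cogen (C := C) (α (φ i))) m
  have h3 : cogen (C := C) (φ i) (h m) = cogen (C := C) (α (φ i)) m := congrFun (hcomp m) i
  change φ i (h m) = α (φ i) m
  rw [← h1, ← h2, LinearMap.comp_apply, h3, LinearMap.comp_apply]

end Annihilators

/-! ### Subcomodules as comodules, and modules as their duals -/

section Subcomodule

variable {K : Type u} {C : Type v} [Field K] [AddCommGroup C] [Module K C] [Coalgebra K C]
variable {M : Type w} [AddCommGroup M] [Module K M] [LeftComodule K C M]

/-- The coaction on a subcomodule. -/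
noncomputable def subcoact (N : Submodule K M) (hN : IsSubcomodule K C M N) :
    N →ₗ[K] C ⊗[K] N :=
  (LinearEquiv.ofInjective (N.subtype.lTensor C)
    (Module.Flat.lTensor_preserves_injective_linearMap _ N.subtype_injective)).symm.toLinearMap ∘ₗ
  LinearMap.codRestrict _ (coact ∘ₗ N.subtype) fun m => hN m m.2

theorem lTensor_subtype_subcoact (N : Submodule K M) (hN : IsSubcomodule K C M N) (m : N) :
    N.subtype.lTensor C (subcoact N hN m) = coact (m : M) :=
  congrArg Subtype.val ((LinearEquiv.ofInjective (N.subtype.lTensor C)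
    (Module.Flat.lTensor_preserves_injective_linearMap _ N.subtype_injective)).apply_symm_apply
      ⟨coact (m : M), hN m m.2⟩)

/-- A subcomodule as a comodule. -/
@[reducible]
noncomputable def ofIsSubcomodule (N : Submodule K M) (hN : IsSubcomodule K C M N) :
    LeftComodule K C N where
  coact := subcoact N hN
  coassoc := by
    refine LinearMap.ext fun m => ?_
    -- By flatness, coassociativity may be checked after embedding in `C ⊗ (C ⊗ M)`.
    refine Module.Flat.lTensor_preserves_injective_linearMap (M := C) _
      (Module.Flat.lTensor_preserves_injective_linearMap (M := C) _ N.subtype_injective) ?_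
    have h := LinearMap.congr_fun (coassoc (K := K) (C := C) (M := M)) (m : M)
    have hL : ∀ t : C ⊗[K] N, (N.subtype.lTensor C).lTensor C
          (TensorProduct.assoc K C C N
            ((Coalgebra.comul (R := K) (A := C)).rTensor N t)) =
        TensorProduct.assoc K C C M ((Coalgebra.comul (R := K) (A := C)).rTensor M
          (N.subtype.lTensor C t)) := by
      intro t
      induction t with
      | zero => simp
      | add x y hx hy => simp only [map_add, hx, hy]
      | tmul c x =>
        simp only [LinearMap.lTensor_tmul, LinearMap.rTensor_tmul]
        induction (Coalgebra.comul (R := K) c) with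
        | zero => simp
        | add x y hx hy => simp only [map_add, add_tmul, hx, hy]
        | tmul a b => simp
    have hR : ∀ t : C ⊗[K] N, (N.subtype.lTensor C).lTensor C ((subcoact N hN).lTensor C t) =
        (coact (K := K) (C := C) (M := M)).lTensor C (N.subtype.lTensor C t) := by
      intro t
      induction t with
      | zero => simp
      | add x y hx hy => simp only [map_add, hx, hy]
      | tmul c x =>
        simp only [LinearMap.lTensor_tmul, lTensor_subtype_subcoact, Submodule.subtype_apply]
    simp only [LinearMap.comp_apply, LinearEquiv.coe_coe] at h ⊢
    rw [hL, hR, lTensor_subtype_subcoact, h]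
  counit_coact := by
    refine LinearMap.ext fun m => ?_
    refine Module.Flat.lTensor_preserves_injective_linearMap (M := K) _ N.subtype_injective ?_
    have h := LinearMap.congr_fun (counit_coact (K := K) (C := C) (M := M)) (m : M)
    have hL : ∀ t : C ⊗[K] N, N.subtype.lTensor K
          ((Coalgebra.counit (R := K) (A := C)).rTensor N t) =
        (Coalgebra.counit (R := K) (A := C)).rTensor M (N.subtype.lTensor C t) := by
      intro t
      induction t with
      | zero => simp
      | add x y hx hy => simp only [map_add, hx, hy]
      | tmul c x => simp
    simp only [LinearMap.comp_apply] at h ⊢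
    rw [hL, lTensor_subtype_subcoact, h]
    simp

/-- A linear map onto a `C^*`-module with finitely generated kernel identifies that module with the
dual of a subcomodule. -/
theorem exists_subcomodule_dual_equiv {X : Type*} [AddCommGroup X] [Module (DualAlg K C) X]
    (π : Module.Dual K M →ₗ[DualAlg K C] X) (hπ : Function.Surjective π)
    (hker : (LinearMap.ker π).FG) :
    ∃ (N : Submodule K M) (hN : IsSubcomodule K C M N),
      letI := ofIsSubcomodule N hN
      Nonempty (Module.Dual K N ≃ₗ[DualAlg K C] X) := by
  have hN := isSubcomodule_coannihilator (LinearMap.ker π)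
  refine ⟨coannihilator (LinearMap.ker π), hN, ?_⟩
  let _ := ofIsSubcomodule _ hN
  have hsub : IsComoduleHom C (coannihilator (LinearMap.ker π)).subtype :=
    LinearMap.ext fun m => lTensor_subtype_subcoact _ hN m
  let ρ := dualHom _ hsub
  have hρ : Function.Surjective ρ := fun φ => LinearMap.exists_extend φ
  -- The kernel of restriction is the annihilator of the common kernel of `ker π`; finite generation
  -- makes this `ker π` itself.
  have hkerρ : LinearMap.ker ρ = LinearMap.ker π := by
    ext φ
    rw [LinearMap.mem_ker]
    constructor
    · intro h
      exact mem_of_vanish_coannihilator hker fun m hm => LinearMap.congr_fun h ⟨m, hm⟩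
    · intro h
      exact LinearMap.ext fun m => m.2 φ h
  exact ⟨(ρ.quotKerEquivOfSurjective hρ).symm ≪≫ₗ Submodule.quotEquivOfEq _ _ hkerρ ≪≫ₗ
    π.quotKerEquivOfSurjective hπ⟩

/-- A finite family in a `C^*`-module gives a map from the dual of `C^ι`. -/
noncomputable def dualPiLift {ι : Type} [Fintype ι] [DecidableEq ι] {X : Type*} [AddCommGroup X]
    [Module (DualAlg K C) X] (x : ι → X) : Module.Dual K (ι → C) →ₗ[DualAlg K C] X where
  toFun F := ∑ i, (WithConv.toConv (F ∘ₗ LinearMap.single K (fun _ : ι => C) i) : DualAlg K C) • x i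
  map_add' F G := by
    rw [← Finset.sum_add_distrib]
    exact Finset.sum_congr rfl fun i _ => by rw [← add_smul]; rfl
  map_smul' f F := by
    rw [RingHom.id_apply, Finset.smul_sum]
    refine Finset.sum_congr rfl fun i _ => ?_
    rw [smul_smul]
    congr 1
    -- Left multiplication in `C^*` is the action on the dual of `C`, so what remains is that
    -- restriction to a coordinate is `C^*`-linear.
    refine congrArg WithConv.toConv (?_ : _ = f • (F ∘ₗ LinearMap.single K (fun _ : ι => C) i))
    ext c
    rw [LinearMap.comp_apply, dual_smul_apply_eq_act, dual_smul_apply_eq_act, LinearMap.comp_apply]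
    congr 1
    ext j
    rw [act_pi]
    by_cases hj : j = i
    · subst hj
      simp
    · simp [Pi.single_eq_of_ne hj]

theorem dualPiLift_surjective {ι : Type} [Fintype ι] [DecidableEq ι] {X : Type*} [AddCommGroup X]
    [Module (DualAlg K C) X] {x : ι → X}
    (hx : Submodule.span (DualAlg K C) (Set.range x) = ⊤) :
    Function.Surjective (dualPiLift (K := K) (C := C) x) := by
  intro y
  obtain ⟨c, rfl⟩ := (Submodule.mem_span_range_iff_exists_fun (DualAlg K C)).1
    (hx ▸ Submodule.mem_top : y ∈ Submodule.span (DualAlg K C) (Set.range x))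
  refine ⟨∑ i, (c i).ofConv ∘ₗ LinearMap.proj i, Finset.sum_congr rfl fun i _ => ?_⟩
  congr 1
  refine WithConv.ofConv_injective (LinearMap.ext fun a => ?_)
  change (∑ j, (c j).ofConv ∘ₗ LinearMap.proj j) (Pi.single i a) = (c i).ofConv a
  rw [LinearMap.sum_apply, Finset.sum_eq_single i]
  · simp
  · intro j _ hj
    simp [Pi.single_eq_of_ne hj]
  · simp

end Subcomodule

end LeftComodule

/-! ### The Noetherian criterion and the duality -/

theorem isLeftArtinianCoalgebra_iff_isNoetherianRing (K : Type u) (C : Type v) [Field K]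
    [AddCommGroup C] [Module K C] [Coalgebra K C] :
    IsLeftArtinianCoalgebra K C ↔ IsNoetherianRing (DualAlg K C) := by
  rw [IsLeftArtinianCoalgebra, LeftComodule.isArtinianComodule_iff_isNoetherian_dual,
    isNoetherianRing_iff]
  exact ⟨fun _ => isNoetherian_of_linearEquiv LeftComodule.dualSelfEquiv,
    fun _ => isNoetherian_of_linearEquiv LeftComodule.dualSelfEquiv.symm⟩

namespace LeftComod

variable (K : Type u) (C : Type v) [Field K] [AddCommGroup C] [Module K C] [Coalgebra K C]

instance faithful_dualFunctor : (dualFunctor K C).Faithful where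
  map_injective {X Y} g h hgh := by
    refine Quiver.Hom.unop_inj (Hom.ext (LinearMap.ext fun m => LeftComodule.eq_of_dual_eq
      (K := K) fun φ => ?_))
    exact LinearMap.congr_fun (LinearMap.congr_fun (congrArg ModuleCat.Hom.hom hgh) φ) m

variable [IsNoetherianRing (DualAlg K C)]

theorem noetherian_eq_finitelyGenerated : noetherian K C = finitelyGenerated K C := by
  ext X
  exact ⟨fun h => have : IsNoetherian (DualAlg K C) X := h
      (inferInstance : Module.Finite (DualAlg K C) X),
    fun h => have : Module.Finite (DualAlg K C) X := h
      (inferInstance : IsNoetherian (DualAlg K C) X)⟩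

theorem artinian_eq_finitelyCogenerated : artinian K C = finitelyCogenerated K C := by
  ext X
  rw [artinian, finitelyCogenerated, LeftComodule.isArtinianComodule_iff_isNoetherian_dual,
    LeftComodule.isFinitelyCogenerated_iff_finite_dual]
  exact ⟨fun _ => inferInstance, fun _ => inferInstance⟩

theorem exists_finitelyCogenerated_iso {X : ModuleCat.{max u v} (DualAlg K C)}
    (hX : finitelyGenerated K C X) :
    ∃ Y : LeftComod K C, finitelyCogenerated K C Y ∧
      Nonempty ((dualFunctor K C).obj (Opposite.op Y) ≅ X) := by
  have : Module.Finite (DualAlg K C) X := hX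
  obtain ⟨n, x, hx⟩ := Module.Finite.exists_fin (R := DualAlg K C) (M := X)
  have hs := LeftComodule.dualPiLift_surjective hx
  have hfin : Module.Finite (DualAlg K C) (Module.Dual K (Fin n → C)) := by
    refine ⟨Submodule.fg_iff_exists_fin_generating_family.2 ⟨n,
      -- These forms generate because the morphism `C^n → C^n` they define is the identity.
      fun i => Coalgebra.counit (R := K) (A := C) ∘ₗ LinearMap.proj i,
      LeftComodule.injective_cogenPi_iff.1 ?_⟩⟩
    have hid : LeftComodule.IsComoduleHom C (LinearMap.id : (Fin n → C) →ₗ[K] Fin n → C) :=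
      LeftComodule.isComoduleHom_iff_act.2 fun _ _ => rfl
    have h := LeftComodule.eq_cogenPi hid
    simp only [LinearMap.comp_id] at h
    rw [← h]
    exact Function.injective_id
  -- `(C^n)^*` is finitely generated over a Noetherian ring, hence so is the kernel of the
  -- presentation.
  obtain ⟨N, hN, ⟨e⟩⟩ := LeftComodule.exists_subcomodule_dual_equiv _ hs
    (IsNoetherian.noetherian _)
  let _ := LeftComodule.ofIsSubcomodule N hN
  refine ⟨LeftComod.mk N, LeftComodule.isFinitelyCogenerated_iff_finite_dual.2 ?_,
    ⟨e.toModuleIso⟩⟩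
  exact Module.Finite.equiv e.symm

theorem isDuality_finitelyCogenerated_finitelyGenerated :
    IsDuality K C (finitelyCogenerated K C) (finitelyGenerated K C) := by
  refine ⟨fun X => LeftComodule.isFinitelyCogenerated_iff_finite_dual.1 X.unop.property, ?_⟩
  have hfull : ((finitelyCogenerated K C).ι.op ⋙ dualFunctor K C).Full := by
    refine ⟨fun {X Y} α => ?_⟩
    obtain ⟨h, hh, hα⟩ := LeftComodule.exists_dualHom_eq X.unop.property α.hom
    let k : Y.unop.obj ⟶ X.unop.obj := ⟨h, hh⟩
    exact ⟨(ObjectProperty.homMk k).op, ModuleCat.hom_ext hα⟩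
  have hfaithful : ((finitelyCogenerated K C).ι.op ⋙ dualFunctor K C).Faithful := inferInstance
  refine { faithful := ?_, full := ?_, essSurj := ⟨fun X => ?_⟩ }
  -- Fullness and faithfulness pass to the lift, since composing it with the fully faithful
  -- inclusion gives back the dual functor.
  · exact Functor.Faithful.of_comp_iso (ObjectProperty.liftCompιIso _ _ _)
  · exact Functor.Full.of_comp_faithful_iso (ObjectProperty.liftCompιIso _ _ _)
  obtain ⟨Y, hY, ⟨e⟩⟩ := exists_finitelyCogenerated_iso K C X.property
  exact ⟨Opposite.op ⟨Y, hY⟩, ⟨(ObjectProperty.fullyFaithfulι _).preimageIso e⟩⟩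

end LeftComod

theorem mainTheorem7 (K : Type u) (C : Type v) [Field K] [AddCommGroup C] [Module K C]
    [Coalgebra K C] :
    (IsLeftArtinianCoalgebra K C ↔ IsNoetherianRing (DualAlg K C)) ∧
    (IsLeftArtinianCoalgebra K C →
      LeftComod.artinian K C = LeftComod.finitelyCogenerated K C ∧
      LeftComod.noetherian K C = LeftComod.finitelyGenerated K C ∧
      LeftComod.IsDuality K C (LeftComod.artinian K C) (LeftComod.noetherian K C) ∧
      LeftComod.IsDuality K C (LeftComod.finitelyCogenerated K C)
        (LeftComod.finitelyGenerated K C)) := by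
  refine ⟨isLeftArtinianCoalgebra_iff_isNoetherianRing K C, fun h => ?_⟩
  have := (isLeftArtinianCoalgebra_iff_isNoetherianRing K C).1 h
  have hA := LeftComod.artinian_eq_finitelyCogenerated K C
  have hN := LeftComod.noetherian_eq_finitelyGenerated K C
  have hD := LeftComod.isDuality_finitelyCogenerated_finitelyGenerated K C
  exact ⟨hA, hN, by rwa [hA, hN], hD⟩
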